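/- Let $\mathcal X$ be a measurable space, $L\in\mathbb N$, and let $\ell:\mathbb R^L\times\mathbb R^L\to[0,1]$ be a measurable loss function. Let $\mathbb X$ be a probability distribution on $\mathcal X$, let $f_{\mathrm{true}},y_{\mathrm{adv}}:\mathcal X\to\mathbb R^L$ (ground-truth label and corrupted label) and $p:\mathcal X\to[0,1]$ be measurable, and let $\mathbb D$ be the distribution of $(x,y)$ where $x\sim\mathbb X$ and, given $x$, $y=y_{\mathrm{adv}}(x)$ with probability $p(x)$ and $y=f_{\mathrm{true}}(x)$ with probability $1-p(x)$. For a predictor $f:\mathcal X\to\mathbb R^L$ put $$\mathrm{distortion}_f(x)=\frac{\ell(y_{\mathrm{adv}}(x),f(x))}{\ell(f_{\mathrm{true}}(x),f(x))},\qquad w_f(x)=\frac{1}{1+p(x)(\mathrm{distortion}_f(x)-1)},$$ $$R(f)=\mathbb E_{x\sim\mathbb X}\,\ell(f_{\mathrm{true}}(x),f(x)),\qquad \mathrm{Bias}(f)=\mathbb E_{x\sim\mathbb X}\big[p(x)\,(\mathrm{distortion}_f(x)-1)\,\ell(f_{\mathrm{true}}(x),f(x))\big],$$ and, for $S=((x_i,y_i))_{i=1}^n$,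 $$R_S(f)=\frac1n\sum_{i=1}^n\ell(y_i,f(x_i)),\qquad R_S^w(f)=\frac1n\sum_{i=1}^n w_f(x_i)\,\ell(y_i,f(x_i)).$$ Let $\mathcal F$ be any class of measurable predictors $f:\mathcal X\to\mathbb R^L$, with induced classes $\mathcal H=\{h_f:f\in\mathcal F\}$ and $\mathcal H^w=\{h_f^w:f\in\mathcal F\}$ of functions on $\mathcal X\times\mathbb R^L$, where $h_f(x,y)=\ell(y,f(x))$ and $h^w_f(x,y)=w_f(x)\,\ell(y,f(x))$. For a class $\mathcal G$ of real functions on a set $\mathcal Z$, $z\in\mathcal Z^m$ and $\epsilon>0$ let $\mathcal G(z)=\{(g(z_1),\dots,g(z_m)):g\in\mathcal G\}\subseteq\mathbb R^m$, and let $\mathcal N_\infty(\epsilon,\mathcal G,m)$ be the supremum over $z\in\mathcal Z^m$ of the least number of closed $\epsilon$-balls in $\|\cdot\|_\infty$, centred at points of $\mathcal G(z)$, that cover $\mathcal G(z)$. Fix $\delta>0$ and an integer $n\ge16$, and put $\mathcal M(n)=10\,\mathcal N_\infty(1/n,\mathcal H,2n)$ and $\mathcal M^w(n)=10\,\mathcal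 N_\infty(1/n,\mathcal H^w,2n)$. Assume: 1. (well-definedness) for every $f\in\mathcal F$ and $\mathbb X$-almost every $x$ with $p(x)>0$, $\ell(f_{\mathrm{true}}(x),f(x))>0$ and $1+p(x)(\mathrm{distortion}_f(x)-1)\neq0$ (at the remaining $x$ a quotient with zero denominator is read as $0$); 2. every function in $\mathcal H^w$ takes values in $[0,1]$; 3. (measurability) for $\mathcal G=\mathcal H$ and $\mathcal G=\mathcal H^w$ and every open $U\subseteq\mathbb R^{2n}$, the set $\{z\in(\mathcal X\times\mathbb R^L)^{2n}:\mathcal G(z)\cap U\ne\emptyset\}$ is measurable with respect to the completion of $\mathbb D^{2n}$ (this is automatic, for instance, if $\mathcal F$ is countable). Then there is an event of probability at least $1-\delta$ over $S\sim\mathbb D^n$ on which, for every $f\in\mathcal F$, $$|R(f)+\mathrm{Bias}(f)-R_S(f)|\le C\left(\sqrt{\mathbb V_S(f)\,\frac{\ln(\mathcal M(n)/\delta)}{n}}+\frac{\ln(\mathcal M(n)/\delta)}{n}\right),$$ $$|R(f)-R_S^w(f)|\le C\left(\sqrt{\mathbb V^w_S(f)\,\frac{\ln(\mathcal M^w(n)/\delta)}{n}}+\frac{\ln(\mathcal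 M^w(n)/\delta)}{n}\right),$$ where $\mathbb V_S(f)$ and $\mathbb V_S^w(f)$ are the sample variances (with normalization $1/(n-1)$) of $(h_f(x_i,y_i))_{i=1}^n$ and $(h_f^w(x_i,y_i))_{i=1}^n$, and $C>0$ is an absolute constant (independent of $\mathcal X,L,\ell,\mathbb X,f_{\mathrm{true}},y_{\mathrm{adv}},p,\mathcal F,n,\delta$). -/

import Mathlib

open MeasureTheory
open scoped NNReal ENNReal

noncomputable section

namespace Distillation

/-- The distribution `𝔻` of a noisy labelled example `(x, y)`: the instance `x` is drawn from `PX`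
and, given `x`, the label is `yadv x` with probability `p x` and `ftrue x` with probability
`1 - p x`. -/
def noisyDist {X Y : Type*} [MeasurableSpace X] [MeasurableSpace Y] (PX : Measure X)
    (ftrue yadv : X → Y) (p : X → ℝ) : Measure (X × Y) :=
  (PX.withDensity fun x => ENNReal.ofReal (p x)).map (fun x => (x, yadv x)) +
    (PX.withDensity fun x => ENNReal.ofReal (1 - p x)).map (fun x => (x, ftrue x))

/-- `distortion_f(x) = ℓ(yadv(x), f(x)) / ℓ(ftrue(x), f(x))`. -/
def distortion {X Y V : Type*} (l : Y → V → ℝ) (ftrue yadv : X → Y) (f : X → V) (x : X) : ℝ :=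
  l (yadv x) (f x) / l (ftrue x) (f x)

/-- The debiasing weight `w_f(x) = 1 / (1 + p(x) (distortion_f(x) - 1))`. -/
def weight {X Y V : Type*} (l : Y → V → ℝ) (ftrue yadv : X → Y) (p : X → ℝ) (f : X → V)
    (x : X) : ℝ :=
  1 / (1 + p x * (distortion l ftrue yadv f x - 1))

/-- The clean risk `R(f) = 𝔼_x ℓ(ftrue(x), f(x))`. -/
def risk {X Y V : Type*} [MeasurableSpace X] (PX : Measure X) (l : Y → V → ℝ) (ftrue : X → Y)
    (f : X → V) : ℝ :=
  ∫ x, l (ftrue x) (f x) ∂PX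

/-- `Bias(f) = 𝔼_x [p(x) (distortion_f(x) - 1) ℓ(ftrue(x), f(x))]`. -/
def bias {X Y V : Type*} [MeasurableSpace X] (PX : Measure X) (l : Y → V → ℝ)
    (ftrue yadv : X → Y) (p : X → ℝ) (f : X → V) : ℝ :=
  ∫ x, p x * (distortion l ftrue yadv f x - 1) * l (ftrue x) (f x) ∂PX

/-- The function `h_f(x, y) = ℓ(y, f(x))`. -/
def lossFun {X Y V : Type*} (l : Y → V → ℝ) (f : X → V) (z : X × Y) : ℝ :=
  l z.2 (f z.1)

/-- The function `h_f^w(x, y) = w_f(x) ℓ(y, f(x))`. -/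
def weightedLossFun {X Y V : Type*} (l : Y → V → ℝ) (ftrue yadv : X → Y) (p : X → ℝ)
    (f : X → V) (z : X × Y) : ℝ :=
  weight l ftrue yadv p f z.1 * l z.2 (f z.1)

/-- The mean of a finite sequence of reals. -/
def sampleMean {n : ℕ} (v : Fin n → ℝ) : ℝ :=
  (∑ i, v i) / n

/-- The (unbiased) sample variance of a finite sequence of reals. -/
def sampleVariance {n : ℕ} (v : Fin n → ℝ) : ℝ :=
  (∑ i, (v i - sampleMean v) ^ 2) / ((n : ℝ) - 1)

/-- The empirical risk `R_S(f)`. -/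
def empRisk {X Y V : Type*} (l : Y → V → ℝ) {n : ℕ} (S : Fin n → X × Y) (f : X → V) : ℝ :=
  sampleMean fun i => l (S i).2 (f (S i).1)

/-- The weighted empirical risk `R_S^w(f)`. -/
def weightedEmpRisk {X Y V : Type*} (l : Y → V → ℝ) (ftrue yadv : X → Y) (p : X → ℝ) {n : ℕ}
    (S : Fin n → X × Y) (f : X → V) : ℝ :=
  sampleMean fun i => weight l ftrue yadv p f (S i).1 * l (S i).2 (f (S i).1)

/-- `H(z) = {(h(z₁), …, h(zₘ)) : h ∈ H} ⊆ ℝᵐ`. -/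
def projection {Z : Type*} (H : Set (Z → ℝ)) {m : ℕ} (z : Fin m → Z) : Set (Fin m → ℝ) :=
  (fun h i => h (z i)) '' H

/-- The growth function `𝒩_∞(ε, H, m)`: the supremum over `z ∈ Zᵐ` of the smallest number of
`ε`-balls of the sup norm, centred at points of `H(z)`, that cover `H(z)`. -/
def growthNumber {Z : Type*} (ε : ℝ≥0) (H : Set (Z → ℝ)) (m : ℕ) : ℕ∞ :=
  ⨆ z : Fin m → Z, Metric.coveringNumber ε (projection H z)

/-- `M(n) = 10 𝒩_∞(1/n, H, 2n)`. -/
def growthM {Z : Type*} (H : Set (Z → ℝ)) (n : ℕ) : ℝ :=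
  10 * ((growthNumber (1 / (n : ℝ≥0)) H (2 * n)).toNat : ℝ)

/-- The set-valued map `z ↦ H(z)` on `Zᵐ` is measurable with respect to (the completion of) `μᵐ`:
the event that `H(z)` meets a given open set is measurable. -/
def MeasurableProjection {Z : Type*} [MeasurableSpace Z] (H : Set (Z → ℝ)) (μ : Measure Z)
    (m : ℕ) : Prop :=
  ∀ U : Set (Fin m → ℝ), IsOpen U →
    NullMeasurableSet {z : Fin m → Z | (projection H z ∩ U).Nonempty}
      (Measure.pi fun _ : Fin m => μ)

/-- The bound `√(V · ln(M/δ)/n) + ln(M/δ)/n`. -/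
def bernsteinRate (V M δ : ℝ) (n : ℕ) : ℝ :=
  √(V * (Real.log (M / δ) / n)) + Real.log (M / δ) / n

end Distillation

end

/-! Under the corrupted distribution `h_f` has mean `R(f) + Bias(f)`, while the weight is chosen so
that `h_f^w` has mean `R(f)`: averaging over the label at `x` multiplies the clean loss by exactly
`1 / w_f(x)` (`integral_lossFun_noisyDist`, `integral_weightedLossFun_noisyDist`). Both claims are
therefore instances of one uniform empirical Bernstein inequality for classes of `[0,1]`-valued
functions, `exists_measurableSet_forall_abs_le_bernsteinRate`, each used with failure probability `δ
/ 2`.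

That inequality is proved by symmetrization. A ghost sample replaces the mean
(`measure_exists_deviation_le_two_mul`), which needs an empirical Bernstein bound for a single
function only with probability `1/2`, so Chebyshev suffices. The law of the double sample is
invariant under swapping paired entries, so it is enough to count bad swaps of a fixed double sample
(`card_mul_measure_le_of_forall_ncard_le`). There a `1/n`-cover makes the class finite, and for each
centre Hoeffding's inequality controls two signed sums: differences of values, and differences of
squared deviations from the swap-invariant pooled mean (`card_not_balanced_swapped_le`). When both
are small relative to their quadratic variation, the deviation is bounded by the variance of the
first half alone, and that variance also dominates the variance of the second half
(`Balanced.bounds`). -/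

namespace Distillation

/-! ### Squared deviations from the mean. -/

/-- The sum of the squared deviations of a finite sequence from its mean. -/
noncomputable def sqDev {n : ℕ} (v : Fin n → ℝ) : ℝ :=
  ∑ i, (v i - sampleMean v) ^ 2

theorem sqDev_nonneg {n : ℕ} (v : Fin n → ℝ) : 0 ≤ sqDev v :=
  Finset.sum_nonneg fun _ _ => sq_nonneg _

theorem natCast_mul_sampleMean {n : ℕ} (hn : 0 < n) (v : Fin n → ℝ) :
    (n : ℝ) * sampleMean v = ∑ i, v i := by
  have : (n : ℝ) ≠ 0 := by positivity
  unfold sampleMean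
  field_simp

theorem sum_sub_sq_eq {n : ℕ} (hn : 0 < n) (v : Fin n → ℝ) (c : ℝ) :
    ∑ i, (v i - c) ^ 2 = sqDev v + n * (sampleMean v - c) ^ 2 := by
  have h : ∑ i, (v i - c) ^ 2 =
      sqDev v + ∑ i, (2 * (sampleMean v - c) * v i
        + ((sampleMean v - c) ^ 2 - 2 * (sampleMean v - c) * sampleMean v)) := by
    unfold sqDev
    rw [← Finset.sum_add_distrib]
    exact Finset.sum_congr rfl fun i _ => by ring
  rw [h, Finset.sum_add_distrib, ← Finset.mul_sum, ← natCast_mul_sampleMean hn]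
  simp only [Finset.sum_const, Finset.card_univ, Fintype.card_fin, nsmul_eq_mul]
  ring

theorem sqDev_le_sum_sub_sq {n : ℕ} (hn : 0 < n) (v : Fin n → ℝ) (c : ℝ) :
    sqDev v ≤ ∑ i, (v i - c) ^ 2 := by
  rw [sum_sub_sq_eq hn]
  have : (0 : ℝ) ≤ n * (sampleMean v - c) ^ 2 := by positivity
  linarith

/-- At scale `1/n`, replacing a sequence by a cover centre changes the unnormalized variance only by
constants, which are absorbed by `r ≥ 1`. -/
theorem sqDev_le_of_abs_sub_le {n : ℕ} (hn : 2 ≤ n) {u v : Fin n → ℝ}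
    (h : ∀ i, |u i - v i| ≤ 1 / n) : sqDev v ≤ 2 * sqDev u + 1 := by
  have hn' : (2 : ℝ) ≤ n := by exact_mod_cast hn
  calc sqDev v ≤ ∑ i, (v i - sampleMean u) ^ 2 := sqDev_le_sum_sub_sq (by omega) _ _
    _ ≤ ∑ i, (2 * (u i - sampleMean u) ^ 2 + 2 * (1 / (n : ℝ)) ^ 2) := by
        refine Finset.sum_le_sum fun i _ => ?_
        have h1 : (u i - v i) ^ 2 ≤ (1 / (n : ℝ)) ^ 2 := sq_le_sq' (by
          linarith [(abs_le.1 (h i)).1]) (abs_le.1 (h i)).2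
        nlinarith [sq_nonneg (u i - sampleMean u + (u i - v i))]
    _ = 2 * sqDev u + 2 / n := by
        rw [Finset.sum_add_distrib, ← Finset.mul_sum]
        simp only [Finset.sum_const, Finset.card_univ, Fintype.card_fin, nsmul_eq_mul]
        unfold sqDev
        field_simp
    _ ≤ 2 * sqDev u + 1 := by
        have : 2 / (n : ℝ) ≤ 1 := by rw [div_le_one (by positivity)]; exact hn'
        linarith

theorem abs_sum_sub_le_of_abs_sub_le {n : ℕ} (hn : 0 < n) {u v : Fin n → ℝ}
    (h : ∀ i, |u i - v i| ≤ 1 / n) : |∑ i, u i - ∑ i, v i| ≤ 1 := by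
  rw [← Finset.sum_sub_distrib]
  calc |∑ i, (u i - v i)| ≤ ∑ i, |u i - v i| := Finset.abs_sum_le_sum_abs _ _
    _ ≤ ∑ _i : Fin n, 1 / (n : ℝ) := Finset.sum_le_sum fun i _ => h i
    _ = 1 := by
      have : (n : ℝ) ≠ 0 := by positivity
      simp [this]

/-! ### Deterministic consequences of balance for a pair of samples. -/

/-- The mean of two sequences of the same length taken together. -/
noncomputable def pooledMean {n : ℕ} (a b : Fin n → ℝ) : ℝ :=
  (sampleMean a + sampleMean b) / 2

/-- The swap-invariant sums of a pair of sequences are dominated by their quadratic variation. -/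
def Balanced {n : ℕ} (r : ℝ) (a b : Fin n → ℝ) : Prop :=
  (∑ i, (a i - b i)) ^ 2 ≤ 4 * r * ∑ i, (a i - b i) ^ 2 ∧
  (∑ i, ((a i - pooledMean a b) ^ 2 - (b i - pooledMean a b) ^ 2)) ^ 2 ≤
    4 * r * ∑ i, ((a i - pooledMean a b) ^ 2 - (b i - pooledMean a b) ^ 2) ^ 2

theorem sampleMean_mem_Icc {n : ℕ} (hn : 0 < n) {a : Fin n → ℝ}
    (ha : ∀ i, a i ∈ Set.Icc (0 : ℝ) 1) : sampleMean a ∈ Set.Icc (0 : ℝ) 1 := by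
  have hn' : (0 : ℝ) < n := by exact_mod_cast hn
  refine ⟨div_nonneg (Finset.sum_nonneg fun i _ => (ha i).1) hn'.le, ?_⟩
  rw [sampleMean, div_le_one hn']
  calc ∑ i, a i ≤ ∑ _i : Fin n, (1 : ℝ) := Finset.sum_le_sum fun i _ => (ha i).2
    _ = n := by simp

/-- With `A`, `B` the squared deviations about the pooled mean, the second balance condition gives
`(A - B)^2 ≤ 4r(A + B)`, hence `B ≤ 3A + 8r`. The first then bounds the difference of sums through
`A` alone, and it remains to compare `A` with `sqDev a`. -/
theorem Balanced.bounds {n : ℕ} (hn : 0 < n) {r : ℝ} (hr : 0 ≤ r) (hrn : 16 * r ≤ n)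
    {a b : Fin n → ℝ} (ha : ∀ i, a i ∈ Set.Icc (0 : ℝ) 1) (hb : ∀ i, b i ∈ Set.Icc (0 : ℝ) 1)
    (h : Balanced r a b) :
    (∑ i, a i - ∑ i, b i) ^ 2 ≤ 64 * r * sqDev a + 128 * r ^ 2 ∧
      sqDev b ≤ 6 * sqDev a + 14 * r := by
  obtain ⟨h1, h2⟩ := h
  have hn' : (0 : ℝ) < n := by exact_mod_cast hn
  set c := pooledMean a b with hc
  have hma := sampleMean_mem_Icc hn ha
  have hmb := sampleMean_mem_Icc hn hb
  have hc0 : 0 ≤ c := by rw [hc, pooledMean]; linarith [hma.1, hmb.1]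
  have hc1 : c ≤ 1 := by rw [hc, pooledMean]; linarith [hma.2, hmb.2]
  set A := ∑ i, (a i - c) ^ 2 with hA
  set B := ∑ i, (b i - c) ^ 2 with hB
  have hA0 : 0 ≤ A := Finset.sum_nonneg fun _ _ => sq_nonneg _
  have hB0 : 0 ≤ B := Finset.sum_nonneg fun _ _ => sq_nonneg _
  have hd : ∑ i, (a i - b i) ^ 2 ≤ 2 * (A + B) := by
    rw [hA, hB, ← Finset.sum_add_distrib, Finset.mul_sum]
    exact Finset.sum_le_sum fun i _ => by nlinarith [sq_nonneg (a i - c + (b i - c))]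
  -- All deviations lie in `[-1, 1]`, so fourth powers are at most squares.
  have hq : ∑ i, ((a i - c) ^ 2 - (b i - c) ^ 2) ^ 2 ≤ A + B := by
    rw [hA, hB, ← Finset.sum_add_distrib]
    refine Finset.sum_le_sum fun i _ => ?_
    have e1 : (a i - c) ^ 2 ≤ 1 := by
      have := (ha i).1; have := (ha i).2; nlinarith
    have e2 : (b i - c) ^ 2 ≤ 1 := by
      have := (hb i).1; have := (hb i).2; nlinarith
    nlinarith [sq_nonneg (a i - c), sq_nonneg (b i - c),
      mul_nonneg (sq_nonneg (a i - c)) (sq_nonneg (b i - c))]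
  have hAB : ∑ i, ((a i - c) ^ 2 - (b i - c) ^ 2) = A - B := by
    rw [Finset.sum_sub_distrib]
  rw [hAB] at h2
  have h2' : (A - B) ^ 2 ≤ 4 * r * (A + B) :=
    h2.trans (mul_le_mul_of_nonneg_left hq (by positivity))
  have hBle : B ≤ 3 * A + 8 * r := by
    by_contra! hlt
    nlinarith [sq_nonneg ((A + B) / 2 - 4 * r)]
  have hAeq : A = sqDev a + n * (sampleMean a - c) ^ 2 := sum_sub_sq_eq hn a c
  set D := ∑ i, a i - ∑ i, b i with hD
  have hDm : D = n * (2 * (sampleMean a - c)) := by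
    rw [hD, ← natCast_mul_sampleMean hn a, ← natCast_mul_sampleMean hn b, hc, pooledMean]; ring
  rw [Finset.sum_sub_distrib] at h1
  have hD1 : D ^ 2 ≤ 32 * r * A + 64 * r ^ 2 := by
    have := mul_le_mul_of_nonneg_left hd (by positivity : 0 ≤ 4 * r)
    nlinarith
  -- `A` exceeds `sqDev a` by `D^2 / (4n)`, itself bounded through `A`. As `8r ≤ n / 2`, the term in
  -- `A` on the right can be absorbed on the left.
  have hnA : n * A ≤ n * sqDev a + 8 * r * A + 16 * r ^ 2 := by
    have : n * A = n * sqDev a + D ^ 2 / 4 := by rw [hAeq, hDm]; ring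
    linarith
  have hA2 : A ≤ 2 * sqDev a + 2 * r := by
    have h3 : n * A ≤ n * (2 * sqDev a + 2 * r) := by nlinarith
    exact le_of_mul_le_mul_left h3 hn'
  refine ⟨by nlinarith, ?_⟩
  have : sqDev b ≤ B := sqDev_le_sum_sub_sq hn b c
  linarith

/-- The pairs of sequences violating the two-sample empirical Bernstein inequality. -/
def deviantPairs (n : ℕ) (r : ℝ) : Set ((Fin n → ℝ) × (Fin n → ℝ)) :=
  {v | 100 * (√(r * sqDev v.1) + r) <
    |∑ i, v.1 i - ∑ i, v.2 i| + 8 * (√(r * sqDev v.2) + r)}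

/-- Continuity makes the set of violating pairs open, and the measurability hypothesis on the class
concerns open sets only. -/
theorem continuous_sqDev {n : ℕ} : Continuous (sqDev : (Fin n → ℝ) → ℝ) := by
  unfold sqDev sampleMean
  fun_prop

theorem isOpen_deviantPairs (n : ℕ) (r : ℝ) : IsOpen (deviantPairs n r) := by
  have := continuous_sqDev (n := n)
  exact isOpen_lt (by fun_prop) (by fun_prop)

/-- Balance is known only for cover centres `a, b`; the slack in the constants 100 and 8 transfers
the conclusion to every pair `a', b'` within `1/n`. -/
theorem Balanced.notMem_deviantPairs {n : ℕ} (hn : 2 ≤ n) {r : ℝ} (hr : 1 ≤ r)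
    (hrn : 16 * r ≤ n) {a b a' b' : Fin n → ℝ} (ha : ∀ i, a i ∈ Set.Icc (0 : ℝ) 1)
    (hb : ∀ i, b i ∈ Set.Icc (0 : ℝ) 1) (haa' : ∀ i, |a i - a' i| ≤ 1 / n)
    (hbb' : ∀ i, |b i - b' i| ≤ 1 / n) (h : Balanced r a b) :
    (a', b') ∉ deviantPairs n r := by
  obtain ⟨h1, h2⟩ := h.bounds (by omega) (by linarith) hrn ha hb
  have qa : sqDev a ≤ 2 * sqDev a' + 1 :=
    sqDev_le_of_abs_sub_le hn fun i => by rw [abs_sub_comm]; exact haa' i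
  have qb : sqDev b' ≤ 2 * sqDev b + 1 := sqDev_le_of_abs_sub_le hn hbb'
  have sa := abs_sum_sub_le_of_abs_sub_le (by omega) haa'
  have sb := abs_sum_sub_le_of_abs_sub_le (by omega) hbb'
  have q0 := sqDev_nonneg a'
  simp only [deviantPairs, Set.mem_ofPred_eq, not_lt]
  set s := √(r * sqDev a') with hs
  have hs0 : 0 ≤ s := Real.sqrt_nonneg _
  have hs2 : s ^ 2 = r * sqDev a' := Real.sq_sqrt (by positivity)
  have hrsq : r ≤ r ^ 2 := by nlinarith
  have k1 : |∑ i, a i - ∑ i, b i| ≤ 12 * s + 20 * r := by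
    refine abs_le_of_sq_le_sq ?_ (by positivity)
    have : r * sqDev a ≤ r * (2 * sqDev a' + 1) := by gcongr
    nlinarith [mul_nonneg hs0 (by linarith : 0 ≤ r)]
  have k2 : √(r * sqDev b') ≤ 5 * s + 7 * r := by
    rw [Real.sqrt_le_left (by positivity)]
    have : r * sqDev b' ≤ r * (24 * sqDev a' + 13 + 28 * r) := by gcongr; linarith
    nlinarith [mul_nonneg hs0 (by linarith : 0 ≤ r)]
  have k3 : |∑ i, a' i - ∑ i, b' i| ≤ |∑ i, a i - ∑ i, b i| + 2 := by
    rw [abs_le] at sa sb ⊢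
    have := neg_abs_le (∑ i, a i - ∑ i, b i)
    have := le_abs_self (∑ i, a i - ∑ i, b i)
    constructor <;> linarith
  linarith

/-! ### Concentration of signed sums under uniform signs, by counting. -/

/-- The sign of a swap. -/
noncomputable def swapSign (b : Bool) : ℝ := if b then -1 else 1

/-- The exponential factors over coordinates, and each factor is `2 cosh x ≤ 2 exp (x^2 / 2)`. -/
theorem sum_exp_signed_sum_le {n : ℕ} (d : Fin n → ℝ) (s : ℝ) :
    ∑ σ : Fin n → Bool, Real.exp (s * ∑ i, swapSign (σ i) * d i) ≤
      2 ^ n * Real.exp (s ^ 2 * (∑ i, d i ^ 2) / 2) := by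
  have h1 : ∑ σ : Fin n → Bool, Real.exp (s * ∑ i, swapSign (σ i) * d i) =
      ∏ i, ∑ b : Bool, Real.exp (s * (swapSign b * d i)) := by
    rw [Finset.prod_univ_sum, Fintype.piFinset_univ]
    exact Finset.sum_congr rfl fun σ _ => by rw [Finset.mul_sum, Real.exp_sum]
  rw [h1]
  have h2 : (2 : ℝ) ^ n * Real.exp (s ^ 2 * (∑ i, d i ^ 2) / 2) =
      ∏ i, (2 * Real.exp ((s * d i) ^ 2 / 2)) := by
    rw [Finset.prod_mul_distrib, ← Real.exp_sum]
    simp only [Finset.prod_const, Finset.card_univ, Fintype.card_fin, mul_pow]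
    rw [← Finset.sum_div, ← Finset.mul_sum]
  rw [h2]
  refine Finset.prod_le_prod (fun i _ => Finset.sum_nonneg fun _ _ => (Real.exp_pos _).le)
    fun i _ => ?_
  have := Real.cosh_le_exp_half_sq (s * d i)
  rw [Real.cosh_eq] at this
  simp only [Fintype.sum_bool, swapSign, if_true, Bool.false_eq_true, if_false]
  have e1 : s * (-1 * d i) = -(s * d i) := by ring
  have e2 : s * (1 * d i) = s * d i := by ring
  rw [e1, e2]
  linarith

/-- Hoeffding's inequality for signed sums, in counting form. -/
theorem card_signed_sum_sq_gt_le {n : ℕ} (d : Fin n → ℝ) {r : ℝ} (hr : 0 ≤ r) :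
    (({σ : Fin n → Bool | 4 * r * ∑ i, d i ^ 2 < (∑ i, swapSign (σ i) * d i) ^ 2} :
      Finset (Fin n → Bool)).card : ℝ) ≤ 2 * (2 ^ n * Real.exp (-(2 * r))) := by
  set D := ∑ i, d i ^ 2 with hD
  have hD0 : 0 ≤ D := Finset.sum_nonneg fun _ _ => sq_nonneg _
  rcases hD0.eq_or_lt with h0 | hpos
  · have hd : ∀ i, d i = 0 := fun i => by
      have := (Finset.sum_eq_zero_iff_of_nonneg fun i _ => sq_nonneg (d i)).1 h0.symm i
        (Finset.mem_univ i)
      exact pow_eq_zero_iff (two_ne_zero) |>.1 this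
    have : ({σ : Fin n → Bool | 4 * r * D < (∑ i, swapSign (σ i) * d i) ^ 2} :
        Finset (Fin n → Bool)) = ∅ := by
      ext σ
      simp [hd, ← h0]
    rw [this]
    simp only [Finset.card_empty, Nat.cast_zero]
    positivity
  -- The optimal Chernoff parameter for the threshold `2√(rD)`: the exponent is `4r` at the
  -- threshold and the moment bound costs `2r`, leaving `exp (-2r)`.
  · set s := √(4 * r / D) with hs
    have hs2 : s ^ 2 * D = 4 * r := by
      rw [hs, Real.sq_sqrt (by positivity)]; field_simp
    have key : ∀ σ : Fin n → Bool, 4 * r * D < (∑ i, swapSign (σ i) * d i) ^ 2 →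
        Real.exp (4 * r) ≤ Real.exp (s * ∑ i, swapSign (σ i) * d i) +
          Real.exp (-s * ∑ i, swapSign (σ i) * d i) := by
      intro σ hσ
      set x := ∑ i, swapSign (σ i) * d i
      have h1 : 4 * r ≤ |s * x| := by
        refine le_abs.2 (le_abs.1 ?_)
        refine abs_le_of_sq_le_sq' ?_ (abs_nonneg _) |>.2
        rw [sq_abs, mul_pow]
        have : 4 * r * (s ^ 2 * D) ≤ s ^ 2 * x ^ 2 := by
          have := mul_le_mul_of_nonneg_left hσ.le (sq_nonneg s)
          linarith
        rw [hs2] at this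
        linarith
      rcases le_abs.1 h1 with h | h
      · linarith [Real.exp_le_exp.2 h, Real.exp_pos (-s * x)]
      · rw [← neg_mul] at h
        linarith [Real.exp_le_exp.2 h, Real.exp_pos (s * x)]
    have hsum : (({σ : Fin n → Bool | 4 * r * D < (∑ i, swapSign (σ i) * d i) ^ 2} :
        Finset (Fin n → Bool)).card : ℝ) * Real.exp (4 * r) ≤
        2 * (2 ^ n * Real.exp (2 * r)) := by
      calc _ = ∑ _σ ∈ ({σ : Fin n → Bool | 4 * r * D < (∑ i, swapSign (σ i) * d i) ^ 2} :
            Finset (Fin n → Bool)), Real.exp (4 * r) := by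
              rw [Finset.sum_const, nsmul_eq_mul]
        _ ≤ ∑ σ ∈ ({σ : Fin n → Bool | 4 * r * D < (∑ i, swapSign (σ i) * d i) ^ 2} :
            Finset (Fin n → Bool)), (Real.exp (s * ∑ i, swapSign (σ i) * d i) +
              Real.exp (-s * ∑ i, swapSign (σ i) * d i)) :=
            Finset.sum_le_sum fun σ hσ => key σ (Finset.mem_filter.1 hσ).2
        _ ≤ ∑ σ : Fin n → Bool, (Real.exp (s * ∑ i, swapSign (σ i) * d i) +
              Real.exp (-s * ∑ i, swapSign (σ i) * d i)) :=
            Finset.sum_le_sum_of_subset_of_nonneg (Finset.subset_univ _) fun _ _ _ => by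
              positivity
        _ ≤ 2 * (2 ^ n * Real.exp (2 * r)) := by
            rw [Finset.sum_add_distrib]
            have e1 := sum_exp_signed_sum_le d s
            have e2 := sum_exp_signed_sum_le d (-s)
            rw [neg_sq] at e2
            have : s ^ 2 * (∑ i, d i ^ 2) / 2 = 2 * r := by rw [← hD, hs2]; ring
            rw [this] at e1 e2
            linarith
    have he : Real.exp (2 * r) = Real.exp (-(2 * r)) * Real.exp (4 * r) := by
      rw [← Real.exp_add]; ring_nf
    rw [he] at hsum
    refine le_of_mul_le_mul_right (hsum.trans_eq ?_) (Real.exp_pos (4 * r))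
    ring

/-! ### Covers and random swaps of a double sample. -/

/-- Finiteness matters because `growthM` uses `toNat`, which sends `⊤` to `0`. An `ε/2`-cover of the
cube gives a bound uniform in `z`; halving the radius pays for centres being required to lie in the
projection. -/
theorem growthNumber_ne_top {Z : Type*} {H : Set (Z → ℝ)}
    (hH : ∀ h ∈ H, ∀ z, h z ∈ Set.Icc (0 : ℝ) 1) {ε : ℝ≥0} (hε : ε ≠ 0) (m : ℕ) :
    growthNumber ε H m ≠ ⊤ := by
  set K : Set (Fin m → ℝ) := Set.univ.pi fun _ => Set.Icc (0 : ℝ) 1 with hK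
  have hKc : IsCompact K := isCompact_univ_pi fun _ => isCompact_Icc
  have hε2 : ε / 2 ≠ 0 := by simpa using hε
  obtain ⟨C, hCK, hCf, hC⟩ := Metric.exists_finite_isCover_of_isCompact hε2 hKc
  have hle : growthNumber ε H m ≤ C.encard := by
    refine iSup_le fun z => ?_
    have hsub : projection H z ⊆ K := by
      rintro _ ⟨h, hh, rfl⟩ i _
      exact hH h hh (z i)
    calc Metric.coveringNumber ε (projection H z)
        = Metric.coveringNumber (2 * (ε / 2)) (projection H z) := by
          rw [mul_div_cancel₀ _ (two_ne_zero' ℝ≥0)]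
      _ ≤ Metric.externalCoveringNumber (ε / 2) (projection H z) :=
          Metric.coveringNumber_two_mul_le_externalCoveringNumber _ _
      _ ≤ Metric.externalCoveringNumber (ε / 2) K := Metric.externalCoveringNumber_mono_set hsub
      _ ≤ C.encard := hC.externalCoveringNumber_le_encard
  exact (hle.trans_lt hCf.encard_lt_top).ne

/-- The first component of a pair of sequences after swapping the entries selected by `σ`. -/
def swapped {Z : Type*} {n : ℕ} (σ : Fin n → Bool) (a b : Fin n → Z) (i : Fin n) : Z :=
  if σ i then b i else a i

/-- A swap leaves the pooled mean and both quadratic variations unchanged and only flips signs in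
the two sums, so Hoeffding's count applies once to each. -/
theorem card_not_balanced_swapped_le {n : ℕ} (a b : Fin n → ℝ) {r : ℝ} (hr : 0 ≤ r) :
    (({σ : Fin n → Bool | ¬ Balanced r (swapped σ a b) (swapped σ b a)} :
      Set (Fin n → Bool)).ncard : ℝ) ≤ 4 * (2 ^ n * Real.exp (-(2 * r))) := by
  classical
  have hpool : ∀ σ : Fin n → Bool,
      pooledMean (swapped σ a b) (swapped σ b a) = pooledMean a b := fun σ => by
    unfold pooledMean sampleMean
    rw [← add_div, ← add_div, ← Finset.sum_add_distrib, ← Finset.sum_add_distrib]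
    congr 2
    refine Finset.sum_congr rfl fun i _ => ?_
    by_cases h : σ i = true <;> simp [swapped, h, add_comm]
  set d1 : Fin n → ℝ := fun i => a i - b i with hd1
  set d2 : Fin n → ℝ := fun i =>
    (a i - pooledMean a b) ^ 2 - (b i - pooledMean a b) ^ 2 with hd2
  have hs1 : ∀ σ : Fin n → Bool, ∀ i, swapped σ a b i - swapped σ b a i =
      swapSign (σ i) * d1 i := fun σ i => by
    by_cases h : σ i = true <;> simp [swapped, swapSign, h, hd1]
  have hs2 : ∀ σ : Fin n → Bool, ∀ i, (swapped σ a b i - pooledMean a b) ^ 2 -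
      (swapped σ b a i - pooledMean a b) ^ 2 = swapSign (σ i) * d2 i := fun σ i => by
    by_cases h : σ i = true <;> simp [swapped, swapSign, h, hd2]
  have hsq : ∀ (σ : Fin n → Bool) (d : Fin n → ℝ),
      ∑ i, (swapSign (σ i) * d i) ^ 2 = ∑ i, d i ^ 2 := fun σ d =>
    Finset.sum_congr rfl fun i _ => by
      by_cases h : σ i = true <;> simp [swapSign, h]
  have hsub : {σ : Fin n → Bool | ¬ Balanced r (swapped σ a b) (swapped σ b a)} ⊆
      (({σ : Fin n → Bool | 4 * r * ∑ i, d1 i ^ 2 < (∑ i, swapSign (σ i) * d1 i) ^ 2} :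
        Finset (Fin n → Bool)) ∪
      ({σ : Fin n → Bool | 4 * r * ∑ i, d2 i ^ 2 < (∑ i, swapSign (σ i) * d2 i) ^ 2} :
        Finset (Fin n → Bool)) : Finset (Fin n → Bool)) := by
    intro σ hσ
    simp only [Set.mem_ofPred_eq, Balanced, hpool, hs1, hs2, hsq, not_and_or, not_le] at hσ
    simpa using hσ
  have hcard := Set.ncard_le_ncard hsub (Finset.finite_toSet _)
  rw [Set.ncard_coe_finset] at hcard
  have h1 := card_signed_sum_sq_gt_le d1 hr
  have h2 := card_signed_sum_sq_gt_le d2 hr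
  have h3 : (({σ : Fin n → Bool | ¬ Balanced r (swapped σ a b) (swapped σ b a)} :
      Set (Fin n → Bool)).ncard : ℝ) ≤ _ :=
    Nat.cast_le.2 (hcard.trans (Finset.card_union_le _ _))
  push_cast at h3
  linarith

/-- The splitting of `2 n` indices into two blocks of length `n`. -/
def splitEquiv (n : ℕ) : Fin n ⊕ Fin n ≃ Fin (2 * n) :=
  finSumFinEquiv.trans (finCongr (two_mul n).symm)

/-- The two halves of a sequence of length `2 n`. -/
def halves {Z : Type*} {n : ℕ} (z : Fin (2 * n) → Z) : (Fin n → Z) × (Fin n → Z) :=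
  (fun i => z (splitEquiv n (Sum.inl i)), fun i => z (splitEquiv n (Sum.inr i)))

/-- The concatenation of two sequences of length `n`. -/
def joined {Z : Type*} {n : ℕ} (S : (Fin n → Z) × (Fin n → Z)) : Fin (2 * n) → Z :=
  fun i => Sum.elim S.1 S.2 ((splitEquiv n).symm i)

/-- The permutation of the two blocks that swaps the entries selected by `σ`. -/
def swapSum {n : ℕ} (σ : Fin n → Bool) : Equiv.Perm (Fin n ⊕ Fin n) :=
  Function.Involutive.toPerm
    (Sum.elim (fun i => if σ i then Sum.inr i else Sum.inl i)
      (fun i => if σ i then Sum.inl i else Sum.inr i))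
    (by
      rintro (i | i) <;> by_cases h : σ i = true <;> simp [h])

theorem swapSum_inl {n : ℕ} (σ : Fin n → Bool) (i : Fin n) :
    swapSum σ (Sum.inl i) = if σ i then Sum.inr i else Sum.inl i :=
  rfl

theorem swapSum_inr {n : ℕ} (σ : Fin n → Bool) (i : Fin n) :
    swapSum σ (Sum.inr i) = if σ i then Sum.inl i else Sum.inr i :=
  rfl

/-- The permutation of `2 n` indices that swaps the pairs selected by `σ`. -/
def swapPerm {n : ℕ} (σ : Fin n → Bool) : Equiv.Perm (Fin (2 * n)) :=
  (splitEquiv n).symm.trans ((swapSum σ).trans (splitEquiv n))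

theorem halves_comp_swapPerm {Z : Type*} {n : ℕ} (σ : Fin n → Bool) (z : Fin (2 * n) → Z) :
    halves (z ∘ swapPerm σ) =
      (swapped σ (halves z).1 (halves z).2, swapped σ (halves z).2 (halves z).1) := by
  ext i <;> by_cases h : σ i = true <;>
    simp [halves, swapPerm, swapSum_inl, swapSum_inr, swapped, h]

/-- A cover of `H(z)`, permuted, covers `H(z ∘ swapPerm σ)`. One minimal cover thus serves all
swaps, and a union bound over its centres applies. -/
theorem card_swapPerm_deviant_le {Z : Type*} {H : Set (Z → ℝ)}
    (hH : ∀ h ∈ H, ∀ z, h z ∈ Set.Icc (0 : ℝ) 1) {n : ℕ} (hn : 2 ≤ n) {r : ℝ} (hr : 1 ≤ r)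
    (hrn : 16 * r ≤ n) (z : Fin (2 * n) → Z) :
    (({σ : Fin n → Bool |
        (projection H (z ∘ swapPerm σ) ∩ halves ⁻¹' deviantPairs n r).Nonempty} :
      Set (Fin n → Bool)).ncard : ℝ) ≤
      (growthNumber (1 / (n : ℝ≥0)) H (2 * n)).toNat * (4 * (2 ^ n * Real.exp (-(2 * r)))) := by
  have hn0 : (n : ℝ≥0) ≠ 0 := by
    have : n ≠ 0 := by omega
    exact_mod_cast this
  have htop := growthNumber_ne_top hH (one_div_ne_zero hn0) (2 * n)
  have hle : Metric.coveringNumber (1 / (n : ℝ≥0)) (projection H z) ≤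
      growthNumber (1 / (n : ℝ≥0)) H (2 * n) :=
    le_iSup (fun z : Fin (2 * n) → Z =>
      Metric.coveringNumber (1 / (n : ℝ≥0)) (projection H z)) z
  have htop' := (hle.trans_lt htop.lt_top).ne
  obtain ⟨T, hT⟩ := (Metric.finite_minimalCover
    (ε := 1 / (n : ℝ≥0)) (A := projection H z)).exists_finset_coe
  have hTcover := Metric.isCover_minimalCover htop'
  have hTsub := Metric.minimalCover_subset (ε := 1 / (n : ℝ≥0)) (A := projection H z)
  have hTcard := Metric.encard_minimalCover htop'
  rw [← hT] at hTcover hTsub hTcard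
  rw [Set.encard_coe_eq_coe_finsetCard] at hTcard
  have hTN : T.card ≤ (growthNumber (1 / (n : ℝ≥0)) H (2 * n)).toNat := by
    rw [← hTcard] at hle
    have := ENat.toNat_le_toNat hle htop
    simpa using this
  have hsub : {σ : Fin n → Bool |
        (projection H (z ∘ swapPerm σ) ∩ halves ⁻¹' deviantPairs n r).Nonempty} ⊆
      ⋃ u ∈ T, {σ : Fin n → Bool | ¬ Balanced r (swapped σ (halves u).1 (halves u).2)
        (swapped σ (halves u).2 (halves u).1)} := by
    rintro σ ⟨_, ⟨h, hh, rfl⟩, hdev⟩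
    have hv : (fun i => h (z i)) ∈ projection H z := ⟨h, hh, rfl⟩
    obtain ⟨u, huT, hu⟩ := hTcover hv
    have hclose : ∀ i, |u i - h (z i)| ≤ 1 / n := fun i => by
      have h1 : edist (fun i => h (z i)) u ≤ ((1 / (n : ℝ≥0) : ℝ≥0) : ℝ≥0∞) := hu
      rw [edist_nndist, ENNReal.coe_le_coe] at h1
      have h2 := (dist_le_pi_dist (fun i => h (z i)) u i).trans (NNReal.coe_le_coe.2 h1)
      rw [abs_sub_comm, ← Real.dist_eq]
      simpa using h2
    -- Centres belong to the projection, so they inherit values in `[0,1]`, as `Balanced.bounds`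
    -- requires.
    obtain ⟨g, hg, hgu⟩ := hTsub huT
    have hu01 : ∀ i, u i ∈ Set.Icc (0 : ℝ) 1 := fun i => by
      rw [← hgu]; exact hH g hg (z i)
    simp only [Set.mem_iUnion, Set.mem_ofPred_eq]
    refine ⟨u, huT, fun hbal => ?_⟩
    have key : ∀ w : Fin (2 * n) → ℝ, w = u ∘ swapPerm σ →
        Balanced r (halves w).1 (halves w).2 := by
      rintro w rfl
      rw [halves_comp_swapPerm]
      exact hbal
    exact (key _ rfl).notMem_deviantPairs hn hr hrn (fun _ => hu01 _) (fun _ => hu01 _)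
      (fun _ => hclose _) (fun _ => hclose _) hdev
  calc (({σ : Fin n → Bool |
        (projection H (z ∘ swapPerm σ) ∩ halves ⁻¹' deviantPairs n r).Nonempty} :
      Set (Fin n → Bool)).ncard : ℝ)
      ≤ ((⋃ u ∈ T, {σ : Fin n → Bool | ¬ Balanced r (swapped σ (halves u).1 (halves u).2)
        (swapped σ (halves u).2 (halves u).1)}).ncard : ℝ) :=
        Nat.cast_le.2 (Set.ncard_le_ncard hsub (Set.toFinite _))
    _ ≤ ((∑ u ∈ T, {σ : Fin n → Bool | ¬ Balanced r (swapped σ (halves u).1 (halves u).2)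
        (swapped σ (halves u).2 (halves u).1)}.ncard : ℕ) : ℝ) :=
        Nat.cast_le.2 (Finset.set_ncard_biUnion_le _ _)
    _ ≤ ∑ _u ∈ T, 4 * (2 ^ n * Real.exp (-(2 * r))) := by
        push_cast
        exact Finset.sum_le_sum fun u _ => card_not_balanced_swapped_le _ _ (by linarith)
    _ ≤ _ := by
        rw [Finset.sum_const, nsmul_eq_mul]
        gcongr

/-! ### Product measures, swap averaging and the ghost sample. -/

variable {Z : Type*} [MeasurableSpace Z] (μ : Measure Z) [IsProbabilityMeasure μ]

theorem measurePreserving_comp_equiv {ι κ : Type*} [Fintype ι] [Fintype κ] (e : ι ≃ κ) :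
    MeasurePreserving (fun z : κ → Z => z ∘ e)
      (Measure.pi fun _ : κ => μ) (Measure.pi fun _ : ι => μ) := by
  convert measurePreserving_piCongrLeft (fun _ : ι => μ) e.symm using 1
  ext z i
  have := Equiv.piCongrLeft_apply_apply (fun _ : ι => Z) e.symm z (e i)
  rw [e.symm_apply_apply] at this
  exact this.symm

theorem measurePreserving_joined (n : ℕ) :
    MeasurePreserving (joined : (Fin n → Z) × (Fin n → Z) → Fin (2 * n) → Z)
      ((Measure.pi fun _ : Fin n => μ).prod (Measure.pi fun _ : Fin n => μ))
      (Measure.pi fun _ : Fin (2 * n) => μ) :=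
  (measurePreserving_comp_equiv μ (splitEquiv n).symm).comp
    (measurePreserving_sumPiEquivProdPi_symm (fun _ : Fin n ⊕ Fin n => μ))

/-- If every orbit of a null-measurable set under a finite family of measure-preserving maps has
at most `c` members in the set, then the set has measure at most `c / card`. -/
theorem card_mul_measure_le_of_forall_ncard_le {Ω I : Type*} [MeasurableSpace Ω] [Fintype I]
    {ν : Measure Ω} [IsProbabilityMeasure ν] {T : I → Ω → Ω}
    (hT : ∀ i, MeasurePreserving (T i) ν ν) {A : Set Ω} (hA : NullMeasurableSet A ν) {c : ℝ}
    (hc : ∀ ω, (({i | T i ω ∈ A} : Set I).ncard : ℝ) ≤ c) :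
    (Fintype.card I : ℝ≥0∞) * ν A ≤ ENNReal.ofReal c := by
  classical
  have h1 : ∀ i, ∫⁻ ω, (T i ⁻¹' A).indicator 1 ω ∂ν = ν A := fun i => by
    rw [lintegral_indicator_one₀ (hA.preimage (hT i).quasiMeasurePreserving),
      (hT i).measure_preimage hA]
  calc (Fintype.card I : ℝ≥0∞) * ν A = ∑ i : I, ∫⁻ ω, (T i ⁻¹' A).indicator 1 ω ∂ν := by
        simp only [h1, Finset.sum_const, Finset.card_univ, nsmul_eq_mul]
    _ = ∫⁻ ω, ∑ i : I, (T i ⁻¹' A).indicator 1 ω ∂ν := by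
        rw [lintegral_finsetSum']
        exact fun i _ => (aemeasurable_indicator_const_iff 1).2
          (hA.preimage (hT i).quasiMeasurePreserving)
    _ ≤ ∫⁻ _ω, ENNReal.ofReal c ∂ν := by
        refine lintegral_mono fun ω => ?_
        have : ∑ i : I, (T i ⁻¹' A).indicator (1 : Ω → ℝ≥0∞) ω =
            ((({i | T i ω ∈ A} : Set I).ncard : ℕ) : ℝ≥0∞) := by
          simp only [Set.indicator_apply, Set.mem_preimage, Pi.one_apply, Finset.sum_boole]
          rw [Set.ncard_eq_toFinset_card']
          congr 2
          ext i
          simp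
        rw [this, ← ENNReal.ofReal_natCast]
        exact ENNReal.ofReal_le_ofReal (hc ω)
    _ = ENNReal.ofReal c := by simp

/-- Chebyshev's inequality for the sum of a bounded function over an i.i.d. sample. -/
theorem measure_abs_sum_sub_ge_le {g : Z → ℝ} (hg : Measurable g) (hg1 : ∀ z, |g z| ≤ 1) (n : ℕ)
    {c : ℝ} (hc : 0 < c) :
    (Measure.pi fun _ : Fin n => μ) {S | c ≤ |∑ i, g (S i) - n * ∫ z, g z ∂μ|} ≤
      ENNReal.ofReal (n * (∫ z, g z ^ 2 ∂μ) / c ^ 2) := by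
  have hLp : MemLp g 2 μ := MemLp.of_bound hg.aestronglyMeasurable 1 (ae_of_all _ hg1)
  have hLpi : ∀ i : Fin n, MemLp (fun S : Fin n → Z => g (S i)) 2 (Measure.pi fun _ => μ) :=
    fun i => hLp.comp_measurePreserving (measurePreserving_eval (fun _ : Fin n => μ) i)
  have hX : MemLp (∑ i : Fin n, fun S : Fin n → Z => g (S i)) 2 (Measure.pi fun _ => μ) :=
    memLp_finsetSum' _ fun i _ => hLpi i
  have hmean : ∫ S, (∑ i : Fin n, fun S : Fin n → Z => g (S i)) S ∂(Measure.pi fun _ => μ) =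
      n * ∫ z, g z ∂μ := by
    simp only [Finset.sum_apply]
    rw [integral_finsetSum _ fun i _ => (hLpi i).integrable (by norm_num)]
    simp only [integral_comp_eval (μ := fun _ : Fin n => μ) hg.aestronglyMeasurable]
    simp
  have hch := ProbabilityTheory.meas_ge_le_variance_div_sq hX hc
  rw [hmean, ProbabilityTheory.variance_sum_pi (X := fun _ : Fin n => g) fun _ => hLp] at hch
  simp only [Finset.sum_apply, Finset.sum_const, Finset.card_univ, Fintype.card_fin,
    nsmul_eq_mul] at hch
  refine hch.trans (ENNReal.ofReal_le_ofReal ?_)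
  gcongr
  exact ProbabilityTheory.variance_le_expectation_sq hg.aestronglyMeasurable

/-- With probability at least `1/2`, a single `[0,1]`-valued function satisfies an empirical
Bernstein inequality. -/
theorem half_le_measure_empirical_bernstein {h : Z → ℝ} (hh : Measurable h)
    (h01 : ∀ z, h z ∈ Set.Icc (0 : ℝ) 1) {n : ℕ} (hn : 16 ≤ n) :
    1 / 2 ≤ (Measure.pi fun _ : Fin n => μ)
      {S | |∑ i, h (S i) - n * ∫ z, h z ∂μ| ≤ 8 * (√(sqDev fun i => h (S i)) + 1)} := by
  have hn' : (16 : ℝ) ≤ n := by exact_mod_cast hn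
  have hint : Integrable h μ := (MemLp.of_bound hh.aestronglyMeasurable 1 (ae_of_all _ fun z => by
    rw [Real.norm_eq_abs, abs_of_nonneg (h01 z).1]; exact (h01 z).2) :
      MemLp h 1 μ).integrable le_rfl
  set m := ∫ z, h z ∂μ with hm
  have hm0 : 0 ≤ m := integral_nonneg fun z => (h01 z).1
  have hm1 : m ≤ 1 := by
    have := integral_mono hint (integrable_const (1 : ℝ)) fun z => (h01 z).2
    simpa using this
  set g : Z → ℝ := fun z => h z - m with hg
  have hgm : Measurable g := hh.sub_const m
  have hg1 : ∀ z, |g z| ≤ 1 := fun z => by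
    rw [abs_le]; constructor <;> linarith [(h01 z).1, (h01 z).2]
  have hgint : ∫ z, g z ∂μ = 0 := by
    rw [hg, integral_sub hint (integrable_const m)]; simp [hm]
  have hgs : ∀ S : Fin n → Z, ∑ i, g (S i) = ∑ i, h (S i) - n * m := fun S => by
    simp [hg, Finset.sum_sub_distrib]
  set v := ∫ z, g z ^ 2 ∂μ with hv
  have hv0 : 0 ≤ v := integral_nonneg fun z => sq_nonneg _
  have cheb := fun {c : ℝ} (hc : 0 < c) => measure_abs_sum_sub_ge_le μ hgm hg1 n hc
  simp only [hgint, mul_zero, sub_zero, hgs, ← hv] at cheb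
  set G := {S : Fin n → Z | |∑ i, h (S i) - n * m| ≤ 8 * (√(sqDev fun i => h (S i)) + 1)} with hG
  have hGm : MeasurableSet G := by
    have h1 : Measurable fun S : Fin n → Z => (fun i => h (S i)) := by fun_prop
    have h2 : Measurable fun S : Fin n → Z => sqDev fun i => h (S i) :=
      continuous_sqDev.measurable.comp h1
    exact measurableSet_le (by fun_prop) (by fun_prop)
  suffices hcompl : (Measure.pi fun _ : Fin n => μ) Gᶜ ≤ 1 / 2 by
    have h1 := prob_add_prob_compl (μ := Measure.pi fun _ : Fin n => μ) hGm
    have h2 : (1 : ℝ≥0∞) ≤ (Measure.pi fun _ : Fin n => μ) G + 1 / 2 :=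
      h1.symm.le.trans (add_le_add le_rfl hcompl)
    rw [show (1 : ℝ≥0∞) / 2 = 1 - 1 / 2 by simp]
    exact tsub_le_iff_right.2 h2
  -- For small total variance the additive constant 8 suffices: Chebyshev gives at most `16 / 64`.
  -- Otherwise the sample variance must first be shown comparable to `v`.
  rcases le_or_gt (n * v) 16 with hsmall | hlarge
  · have hsub : Gᶜ ⊆ {S : Fin n → Z | 8 ≤ |∑ i, h (S i) - n * m|} := by
      intro S hS
      simp only [hG, Set.mem_compl_iff, Set.mem_ofPred_eq, not_le] at hS ⊢
      have := Real.sqrt_nonneg (sqDev fun i => h (S i))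
      linarith
    refine (measure_mono hsub).trans ((cheb (by norm_num)).trans ?_)
    rw [show (1 / 2 : ℝ≥0∞) = ENNReal.ofReal (1 / 2) by
      rw [ENNReal.ofReal_div_of_pos two_pos]; simp]
    exact ENNReal.ofReal_le_ofReal (by linarith)
  · have hvpos : 0 < v := by
      by_contra! hle
      have : v = 0 := le_antisymm hle hv0
      rw [this] at hlarge; norm_num at hlarge
    have hnv : 0 < n * v := by linarith
    have cheb2 := measure_abs_sum_sub_ge_le μ (hgm.pow_const 2)
      (fun z => by
        rw [abs_of_nonneg (sq_nonneg _), ← sq_abs]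
        exact pow_le_one₀ (abs_nonneg _) (hg1 z)) n (half_pos hnv)
    rw [← hv] at cheb2
    have hsub : Gᶜ ⊆ {S : Fin n → Z | 2 * √(n * v) ≤ |∑ i, h (S i) - n * m|} ∪
        {S : Fin n → Z | n * v / 2 ≤ |∑ i, g (S i) ^ 2 - n * v|} := by
      intro S hS
      by_contra hcon
      simp only [Set.mem_union, Set.mem_ofPred_eq, not_or, not_le] at hcon
      obtain ⟨c1, c2⟩ := hcon
      apply hS
      have hq : ∑ i, g (S i) ^ 2 = sqDev (fun i => h (S i)) +
          n * (sampleMean (fun i => h (S i)) - m) ^ 2 :=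
        sum_sub_sq_eq (by omega) (fun i => h (S i)) m
      set x := ∑ i, h (S i) - n * m with hx
      have hxm : x = n * (sampleMean (fun i => h (S i)) - m) := by
        rw [hx, mul_sub, natCast_mul_sampleMean (by omega)]
      have hx2 : x ^ 2 ≤ 4 * (n * v) := by
        have h1 : |x| ^ 2 ≤ (2 * √(n * v)) ^ 2 :=
          pow_le_pow_left₀ (abs_nonneg _) c1.le 2
        rw [sq_abs, mul_pow, Real.sq_sqrt hnv.le] at h1
        linarith
      have hmd : n * (sampleMean (fun i => h (S i)) - m) ^ 2 ≤ 4 * v := by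
        refine le_of_mul_le_mul_left (a := (n : ℝ)) ?_ (by linarith)
        rw [hxm] at hx2
        linarith
      -- The squares about `m` sum to at least `n v / 2`; recentring at the sample mean loses at
      -- most `4v ≤ n v / 4`, by `n ≥ 16`.
      have hsq : n * v / 4 ≤ sqDev (fun i => h (S i)) := by
        have := (abs_lt.1 c2).1
        nlinarith
      have hroot : √(n * v) ≤ 2 * √(sqDev fun i => h (S i)) := by
        rw [Real.sqrt_le_left (by positivity), mul_pow, Real.sq_sqrt (sqDev_nonneg _)]
        linarith
      show |x| ≤ 8 * (√(sqDev fun i => h (S i)) + 1)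
      have := Real.sqrt_nonneg (sqDev fun i => h (S i))
      linarith
    have b1 : (Measure.pi fun _ : Fin n => μ)
        {S : Fin n → Z | 2 * √(n * v) ≤ |∑ i, h (S i) - n * m|} ≤ ENNReal.ofReal (1 / 4) := by
      refine (cheb (by positivity)).trans (ENNReal.ofReal_le_ofReal ?_)
      rw [mul_pow, Real.sq_sqrt hnv.le, div_le_iff₀ (by positivity)]
      linarith
    have b2 : (Measure.pi fun _ : Fin n => μ)
        {S : Fin n → Z | n * v / 2 ≤ |∑ i, g (S i) ^ 2 - n * v|} ≤ ENNReal.ofReal (1 / 4) := by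
      refine cheb2.trans (ENNReal.ofReal_le_ofReal ?_)
      have hg4 : ∫ z, (g z ^ 2) ^ 2 ∂μ ≤ v := by
        have hb : ∀ z, g z ^ 2 ≤ 1 := fun z => by
          rw [← sq_abs]; exact pow_le_one₀ (abs_nonneg _) (hg1 z)
        have hi2 : Integrable (fun z => g z ^ 2) μ :=
          (MemLp.of_bound (hgm.pow_const 2).aestronglyMeasurable 1 (ae_of_all _ fun z => by
            rw [Real.norm_eq_abs, abs_of_nonneg (sq_nonneg _)]; exact hb z) :
              MemLp (fun z => g z ^ 2) 1 μ).integrable le_rfl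
        refine integral_mono_of_nonneg (ae_of_all _ fun z => by positivity) hi2
          (ae_of_all _ fun z => ?_)
        have := hb z
        show (g z ^ 2) ^ 2 ≤ g z ^ 2
        nlinarith [sq_nonneg (g z)]
      rw [div_le_iff₀ (by positivity)]
      have : n * ∫ z, (g z ^ 2) ^ 2 ∂μ ≤ n * v := by gcongr
      nlinarith
    calc (Measure.pi fun _ : Fin n => μ) Gᶜ ≤ _ := measure_mono hsub
      _ ≤ _ := measure_union_le _ _
      _ ≤ ENNReal.ofReal (1 / 4) + ENNReal.ofReal (1 / 4) := add_le_add b1 b2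
      _ = 1 / 2 := by
        rw [← ENNReal.ofReal_add (by norm_num) (by norm_num),
          show (1 / 4 + 1 / 4 : ℝ) = 1 / 2 by norm_num, ENNReal.ofReal_div_of_pos two_pos]
        simp

/-- Ghost-sample symmetrization: the outer measure of the samples on which some function of the
class violates the empirical Bernstein inequality is controlled by the two-sample event. -/
theorem measure_exists_deviation_le_two_mul {H : Set (Z → ℝ)} (hHm : ∀ h ∈ H, Measurable h)
    (hH : ∀ h ∈ H, ∀ z, h z ∈ Set.Icc (0 : ℝ) 1) {n : ℕ} (hn : 16 ≤ n) {r : ℝ} (hr : 1 ≤ r) :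
    (Measure.pi fun _ : Fin n => μ) {S | ∃ h ∈ H, 100 * (√(r * sqDev fun i => h (S i)) + r) <
        |∑ i, h (S i) - n * ∫ z, h z ∂μ|} ≤
      2 * (Measure.pi fun _ : Fin (2 * n) => μ)
        {z | (projection H z ∩ halves ⁻¹' deviantPairs n r).Nonempty} := by
  set ν := Measure.pi fun _ : Fin n => μ with hν
  set A := {z : Fin (2 * n) → Z | (projection H z ∩ halves ⁻¹' deviantPairs n r).Nonempty} with hA
  -- No measurability of `A` is assumed here: its measurable hull has the same measure and has
  -- measurable sections.
  set A' := joined ⁻¹' toMeasurable (Measure.pi fun _ : Fin (2 * n) => μ) A with hA'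
  have hA'm : MeasurableSet A' :=
    (measurePreserving_joined μ n).measurable (measurableSet_toMeasurable _ _)
  have hA'μ : (ν.prod ν) A' = (Measure.pi fun _ : Fin (2 * n) => μ) A := by
    rw [hA', (measurePreserving_joined μ n).measure_preimage
      (measurableSet_toMeasurable _ _).nullMeasurableSet, measure_toMeasurable]
  have hsub : {S : Fin n → Z | ∃ h ∈ H, 100 * (√(r * sqDev fun i => h (S i)) + r) <
        |∑ i, h (S i) - n * ∫ z, h z ∂μ|} ⊆ {S | 1 / 2 ≤ ν (Prod.mk S ⁻¹' A')} := by
    rintro S ⟨h, hh, hS⟩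
    refine (half_le_measure_empirical_bernstein μ (hHm h hh) (hH h hh) hn).trans
      (measure_mono fun S' hS' => ?_)
    refine subset_toMeasurable _ _ ⟨fun i => h (joined (S, S') i), ⟨h, hh, rfl⟩, ?_⟩
    have hhalf : halves (fun i => h (joined (S, S') i)) =
        (fun i => h (S i), fun i => h (S' i)) := by
      ext <;> simp [halves, joined]
    rw [Set.mem_preimage, hhalf]
    simp only [Set.mem_ofPred_eq] at hS'
    show 100 * (√(r * sqDev fun i => h (S i)) + r) <
      |∑ i, h (S i) - ∑ i, h (S' i)| + 8 * (√(r * sqDev fun i => h (S' i)) + r)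
    have hq : √(sqDev fun i => h (S' i)) ≤ √(r * sqDev fun i => h (S' i)) :=
      Real.sqrt_le_sqrt (le_mul_of_one_le_left (sqDev_nonneg _) hr)
    have htri := abs_sub_le (∑ i, h (S i)) (∑ i, h (S' i)) (n * ∫ z, h z ∂μ)
    linarith
  have hmeas : Measurable fun S => ν (Prod.mk S ⁻¹' A') := measurable_measure_prodMk_left hA'm
  -- Every bad sample has a section of measure at least `1/2`; Markov's inequality yields the factor
  -- 2.
  calc _ ≤ ν {S | 1 / 2 ≤ ν (Prod.mk S ⁻¹' A')} := measure_mono hsub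
    _ ≤ (∫⁻ S, ν (Prod.mk S ⁻¹' A') ∂ν) / (1 / 2) :=
        meas_ge_le_lintegral_div hmeas.aemeasurable (by simp) (by simp)
    _ = 2 * (Measure.pi fun _ : Fin (2 * n) => μ) A := by
        rw [← Measure.prod_apply hA'm, hA'μ, one_div, ENNReal.div_eq_inv_mul, inv_inv]

/-! ### The uniform empirical Bernstein inequality. -/

theorem continuous_halves {n : ℕ} :
    Continuous (halves : (Fin (2 * n) → ℝ) → (Fin n → ℝ) × (Fin n → ℝ)) := by
  unfold halves
  fun_prop

theorem measure_exists_deviation_le {H : Set (Z → ℝ)} (hHm : ∀ h ∈ H, Measurable h)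
    (hH : ∀ h ∈ H, ∀ z, h z ∈ Set.Icc (0 : ℝ) 1) {n : ℕ} (hn : 16 ≤ n)
    (hproj : MeasurableProjection H μ (2 * n)) {r : ℝ} (hr : 1 ≤ r) :
    (Measure.pi fun _ : Fin n => μ) {S | ∃ h ∈ H, 100 * (√(r * sqDev fun i => h (S i)) + r) <
        |∑ i, h (S i) - n * ∫ z, h z ∂μ|} ≤
      ENNReal.ofReal (8 * (growthNumber (1 / (n : ℝ≥0)) H (2 * n)).toNat *
        Real.exp (-(2 * r))) := by
  -- If `16r > n` the bad event is empty, since the deviation never exceeds `n < 100r`.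
  rcases le_or_gt (16 * r) n with hrn | hrn
  · refine (measure_exists_deviation_le_two_mul μ hHm hH hn hr).trans ?_
    have hA := hproj _ ((isOpen_deviantPairs n r).preimage continuous_halves)
    have h1 := card_mul_measure_le_of_forall_ncard_le
      (T := fun (σ : Fin n → Bool) (z : Fin (2 * n) → Z) => z ∘ swapPerm σ)
      (fun σ => measurePreserving_comp_equiv μ (swapPerm σ)) hA
      (fun z => card_swapPerm_deviant_le hH (by omega) hr hrn z)
    set N := (growthNumber (1 / (n : ℝ≥0)) H (2 * n)).toNat
    rw [show (N : ℝ) * (4 * (2 ^ n * Real.exp (-(2 * r)))) =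
      (2 ^ n : ℝ) * (4 * N * Real.exp (-(2 * r))) by ring,
      ENNReal.ofReal_mul (by positivity)] at h1
    have hcard : (Fintype.card (Fin n → Bool) : ℝ≥0∞) = ENNReal.ofReal (2 ^ n) := by
      rw [Fintype.card_fun, ENNReal.ofReal_pow (by norm_num)]; simp
    rw [hcard, ENNReal.mul_le_mul_iff_right (by simp) (by simp)] at h1
    calc _ ≤ 2 * ENNReal.ofReal (4 * N * Real.exp (-(2 * r))) := by gcongr
      _ = ENNReal.ofReal 2 * ENNReal.ofReal (4 * N * Real.exp (-(2 * r))) := by simp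
      _ = _ := by rw [← ENNReal.ofReal_mul (by norm_num)]; ring_nf
  · have hempty : {S : Fin n → Z | ∃ h ∈ H, 100 * (√(r * sqDev fun i => h (S i)) + r) <
        |∑ i, h (S i) - n * ∫ z, h z ∂μ|} = ∅ := by
      refine Set.eq_empty_of_forall_notMem ?_
      rintro S ⟨h, hh, hS⟩
      have hn' : (0 : ℝ) < n := by
        have : 0 < n := by omega
        exact_mod_cast this
      have hm0 : 0 ≤ ∫ z, h z ∂μ := integral_nonneg fun z => (hH h hh z).1
      have hm1 : ∫ z, h z ∂μ ≤ 1 := by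
        have := integral_mono_of_nonneg (ae_of_all μ fun z => (hH h hh z).1)
          (integrable_const (1 : ℝ)) (ae_of_all μ fun z => (hH h hh z).2)
        simpa using this
      have hs := sampleMean_mem_Icc (by omega : 0 < n) (a := fun i => h (S i))
        fun i => hH h hh (S i)
      rw [← natCast_mul_sampleMean (by omega) (fun i => h (S i)), ← mul_sub, abs_mul,
        abs_of_pos hn'] at hS
      have h1 : |sampleMean (fun i => h (S i)) - ∫ z, h z ∂μ| ≤ 1 :=
        abs_le.2 ⟨by linarith [hs.1], by linarith [hs.2]⟩
      have h2 : (n : ℝ) * |sampleMean (fun i => h (S i)) - ∫ z, h z ∂μ| ≤ n :=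
        mul_le_of_le_one_right hn'.le h1
      have := Real.sqrt_nonneg (r * sqDev fun i => h (S i))
      linarith
    rw [hempty]
    simp

/-- A uniform empirical Bernstein inequality with the growth number of the class. -/
theorem exists_measurableSet_forall_abs_le_bernsteinRate {Z : Type*} [MeasurableSpace Z] (μ : Measure Z)
    [IsProbabilityMeasure μ] {H : Set (Z → ℝ)} (hHm : ∀ h ∈ H, Measurable h)
    (hH : ∀ h ∈ H, ∀ z, h z ∈ Set.Icc (0 : ℝ) 1) {n : ℕ} (hn : 16 ≤ n)
    (hproj : MeasurableProjection H μ (2 * n)) {δ : ℝ} (hδ : 0 < δ) (hδ1 : δ < 1) :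
    ∃ B : Set (Fin n → Z), MeasurableSet B ∧
      (Measure.pi fun _ : Fin n => μ) B ≤ ENNReal.ofReal (δ / 2) ∧
      ∀ S ∉ B, ∀ h ∈ H, |∫ z, h z ∂μ - sampleMean fun i => h (S i)| ≤
        100 * bernsteinRate (sampleVariance fun i => h (S i)) (growthM H n) δ n := by
  -- The bad set involves a possibly uncountable union, so its outer measure is bounded and `B` is
  -- taken to be its measurable hull.
  suffices hout : (Measure.pi fun _ : Fin n => μ) {S | ∃ h ∈ H,
      100 * bernsteinRate (sampleVariance fun i => h (S i)) (growthM H n) δ n <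
        |∫ z, h z ∂μ - sampleMean fun i => h (S i)|} ≤ ENNReal.ofReal (δ / 2) by
    refine ⟨_, measurableSet_toMeasurable _ _, (measure_toMeasurable _).trans_le hout,
      fun S hS h hh => not_lt.1 fun hlt => hS (subset_toMeasurable _ _ ⟨h, hh, hlt⟩)⟩
  rcases H.eq_empty_or_nonempty with rfl | hne
  · simp
  have hn' : (16 : ℝ) ≤ n := by exact_mod_cast hn
  have hn0 : (n : ℝ≥0) ≠ 0 := by
    have : n ≠ 0 := by omega
    exact_mod_cast this
  set N := (growthNumber (1 / (n : ℝ≥0)) H (2 * n)).toNat with hN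
  have hN1 : 1 ≤ N := by
    obtain ⟨z⟩ : Nonempty Z := nonempty_of_isProbabilityMeasure μ
    have htop := growthNumber_ne_top hH (one_div_ne_zero hn0) (2 * n)
    have hle : Metric.coveringNumber (1 / (n : ℝ≥0)) (projection H fun _ : Fin (2 * n) => z) ≤
        growthNumber (1 / (n : ℝ≥0)) H (2 * n) :=
      le_iSup (fun z : Fin (2 * n) → Z =>
        Metric.coveringNumber (1 / (n : ℝ≥0)) (projection H z)) _
    have hpos : 0 < growthNumber (1 / (n : ℝ≥0)) H (2 * n) :=
      (Metric.coveringNumber_pos_iff.2 (hne.image _)).trans_le hle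
    rw [Nat.one_le_iff_ne_zero, hN, Ne, ENat.toNat_eq_zero, not_or]
    exact ⟨hpos.ne', htop⟩
  have hN1' : (1 : ℝ) ≤ N := by exact_mod_cast hN1
  have hM : growthM H n = 10 * N := rfl
  -- The factor 10 in `growthM` together with `δ < 1` makes the logarithm at least 1, since `10 >
  -- e`.
  have hMδ : 10 ≤ growthM H n / δ := by
    rw [hM, le_div_iff₀ hδ]; nlinarith
  set r := Real.log (growthM H n / δ) with hr
  have hr1 : 1 ≤ r := by
    rw [hr, Real.le_log_iff_exp_le (by linarith)]
    linarith [Real.exp_one_lt_d9]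
  have hexp : Real.exp (-(2 * r)) = (δ / (10 * N)) ^ 2 := by
    rw [show -(2 * r) = ((2 : ℕ) : ℝ) * (-r) by push_cast; ring, Real.exp_nat_mul, Real.exp_neg,
      hr, Real.exp_log (by linarith), hM, inv_div]
  refine (measure_mono ?_).trans ((measure_exists_deviation_le μ hHm hH hn hproj hr1).trans
    (ENNReal.ofReal_le_ofReal ?_))
  · rintro S ⟨h, hh, hS⟩
    refine ⟨h, hh, ?_⟩
    have hnpos : (0 : ℝ) < n := by linarith
    have hrate : √(r * sqDev fun i => h (S i)) + r ≤
        n * bernsteinRate (sampleVariance fun i => h (S i)) (growthM H n) δ n := by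
      have e1 : n * (r / n) = r := by field_simp
      rw [bernsteinRate, ← hr, mul_add, e1]
      gcongr
      refine Real.sqrt_le_iff.2 ⟨by positivity, ?_⟩
      have hv : sqDev (fun i => h (S i)) ≤ n * sampleVariance fun i => h (S i) := by
        unfold sampleVariance
        rw [← mul_div_assoc, le_div_iff₀ (by linarith), mul_comm]
        exact mul_le_mul_of_nonneg_right (by linarith) (sqDev_nonneg _)
      have hv0 : 0 ≤ sampleVariance fun i => h (S i) :=
        div_nonneg (sqDev_nonneg _) (by linarith)
      rw [mul_pow, Real.sq_sqrt (by positivity)]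
      calc r * sqDev (fun i => h (S i)) ≤ r * (n * sampleVariance fun i => h (S i)) := by gcongr
        _ = _ := by field_simp
    have habs : |∑ i, h (S i) - n * ∫ z, h z ∂μ| =
        n * |∫ z, h z ∂μ - sampleMean fun i => h (S i)| := by
      rw [← natCast_mul_sampleMean (by omega) (fun i => h (S i)), ← mul_sub, abs_mul,
        abs_of_pos hnpos, abs_sub_comm]
    rw [habs]
    have := mul_lt_mul_of_pos_left hS hnpos
    linarith
  -- The bound is `8N (δ / (10N))^2 = 8δ^2 / (100N)`, below `δ / 2` as `N ≥ 1` and `δ < 1`.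
  · rw [hexp, ← hN, div_pow, mul_div_assoc', div_le_iff₀ (by positivity)]
    nlinarith [mul_pos hδ hδ, mul_le_mul hN1' hN1' zero_le_one (by linarith),
      mul_nonneg hδ.le (by linarith : (0 : ℝ) ≤ 1 - δ), mul_pos hδ (by linarith : (0 : ℝ) < N)]

/-! ### Expectations under the corrupted distribution. -/

section NoisyDist

variable {X Y : Type*} [MeasurableSpace X] [MeasurableSpace Y] (PX : Measure X)
  [IsProbabilityMeasure PX] {ftrue yadv : X → Y} {p : X → ℝ}

theorem isProbabilityMeasure_noisyDist (hft : Measurable ftrue) (hya : Measurable yadv)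
    (hp : Measurable p) (hp01 : ∀ x, p x ∈ Set.Icc (0 : ℝ) 1) :
    IsProbabilityMeasure (noisyDist PX ftrue yadv p) := by
  constructor
  rw [noisyDist, Measure.add_apply, Measure.map_apply (by fun_prop) MeasurableSet.univ,
    Measure.map_apply (by fun_prop) MeasurableSet.univ, Set.preimage_univ, Set.preimage_univ,
    withDensity_apply _ MeasurableSet.univ, withDensity_apply _ MeasurableSet.univ,
    ← lintegral_add_left (by fun_prop)]
  have : ∀ x, ENNReal.ofReal (p x) + ENNReal.ofReal (1 - p x) = 1 := fun x => by
    rw [← ENNReal.ofReal_add (hp01 x).1 (by linarith [(hp01 x).2])]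
    simp
  simp [this]

theorem integral_noisyDist (hft : Measurable ftrue) (hya : Measurable yadv)
    (hp : Measurable p) (hp01 : ∀ x, p x ∈ Set.Icc (0 : ℝ) 1) {h : X × Y → ℝ}
    (hh : Measurable h) (h01 : ∀ z, h z ∈ Set.Icc (0 : ℝ) 1) :
    ∫ z, h z ∂(noisyDist PX ftrue yadv p) =
      ∫ x, (p x * h (x, yadv x) + (1 - p x) * h (x, ftrue x)) ∂PX := by
  have := isProbabilityMeasure_noisyDist PX hft hya hp hp01
  have hint : Integrable h (noisyDist PX ftrue yadv p) :=
    (MemLp.of_bound hh.aestronglyMeasurable 1 (ae_of_all _ fun z => by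
      rw [Real.norm_eq_abs, abs_of_nonneg (h01 z).1]; exact (h01 z).2) :
        MemLp h 1 _).integrable le_rfl
  have hbd : ∀ q : X → ℝ, Measurable q → (∀ x, q x ∈ Set.Icc (0 : ℝ) 1) → ∀ y : X → Y,
      Measurable y → Integrable (fun x => q x * h (x, y x)) PX := fun q hq hq01 y hy =>
    (MemLp.of_bound (by fun_prop) 1 (ae_of_all _ fun x => by
      rw [Real.norm_eq_abs, abs_of_nonneg (mul_nonneg (hq01 x).1 (h01 _).1)]
      exact mul_le_one₀ (hq01 x).2 (h01 _).1 (h01 _).2) :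
        MemLp (fun x => q x * h (x, y x)) 1 PX).integrable le_rfl
  have hpart : ∀ q : X → ℝ, Measurable q → (∀ x, q x ∈ Set.Icc (0 : ℝ) 1) → ∀ y : X → Y,
      Measurable y → ∫ z, h z ∂((PX.withDensity fun x => ENNReal.ofReal (q x)).map
        (fun x => (x, y x))) = ∫ x, q x * h (x, y x) ∂PX := fun q hq hq01 y hy => by
    rw [integral_map (by fun_prop) hh.aestronglyMeasurable,
      integral_withDensity_eq_integral_toReal_smul (by fun_prop) (by simp)]
    exact integral_congr_ae (ae_of_all _ fun x => by
      simp [ENNReal.toReal_ofReal (hq01 x).1])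
  have h1p : ∀ x, 1 - p x ∈ Set.Icc (0 : ℝ) 1 := fun x =>
    ⟨by linarith [(hp01 x).2], by linarith [(hp01 x).1]⟩
  rw [noisyDist] at hint ⊢
  rw [integral_add_measure (hint.mono_measure (Measure.le_add_right le_rfl))
    (hint.mono_measure (Measure.le_add_left le_rfl)), hpart p hp hp01 yadv hya,
    hpart (fun x => 1 - p x) (by fun_prop) h1p ftrue hft,
    integral_add (hbd p hp hp01 yadv hya) (hbd (fun x => 1 - p x) (by fun_prop) h1p ftrue hft)]

variable {V : Type*} [MeasurableSpace V] {l : Y → V → ℝ} {f : X → V}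

theorem measurable_lossFun (hl : Measurable (Function.uncurry l)) (hf : Measurable f) :
    Measurable (lossFun l f) := by
  have : lossFun l f = fun z : X × Y => Function.uncurry l (z.2, f z.1) := rfl
  rw [this]
  fun_prop

theorem measurable_loss_comp (hl : Measurable (Function.uncurry l)) (hf : Measurable f)
    {y : X → Y} (hy : Measurable y) : Measurable fun x => l (y x) (f x) := by
  have : (fun x => l (y x) (f x)) = fun x => Function.uncurry l (y x, f x) := rfl
  rw [this]
  fun_prop

theorem measurable_weightedLossFun (hft : Measurable ftrue) (hya : Measurable yadv)
    (hp : Measurable p) (hl : Measurable (Function.uncurry l)) (hf : Measurable f) :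
    Measurable (weightedLossFun l ftrue yadv p f) := by
  have hw : Measurable (weight l ftrue yadv p f) :=
    measurable_const.div (measurable_const.add (hp.mul
      (((measurable_loss_comp hl hf hya).div (measurable_loss_comp hl hf hft)).sub_const 1)))
  exact (hw.comp measurable_fst).mul (measurable_lossFun hl hf)

theorem integral_lossFun_noisyDist (hft : Measurable ftrue) (hya : Measurable yadv)
    (hp : Measurable p) (hp01 : ∀ x, p x ∈ Set.Icc (0 : ℝ) 1)
    (hl : Measurable (Function.uncurry l)) (hl01 : ∀ y v, l y v ∈ Set.Icc (0 : ℝ) 1)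
    (hf : Measurable f) (hpos : ∀ᵐ x ∂PX, 0 < p x → 0 < l (ftrue x) (f x)) :
    ∫ z, lossFun l f z ∂(noisyDist PX ftrue yadv p) =
      risk PX l ftrue f + bias PX l ftrue yadv p f := by
  rw [integral_noisyDist PX hft hya hp hp01 (measurable_lossFun hl hf) fun z => hl01 _ _]
  have hae : ∀ᵐ x ∂PX, p x * (distortion l ftrue yadv f x - 1) * l (ftrue x) (f x) =
      p x * (l (yadv x) (f x) - l (ftrue x) (f x)) := by
    filter_upwards [hpos] with x hx
    rcases (hp01 x).1.eq_or_lt with h0 | h0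
    · simp [← h0]
    · have := (hx h0).ne'
      rw [distortion]
      field_simp
  have hmt := measurable_loss_comp hl hf hft
  have hma := measurable_loss_comp hl hf hya
  have hit : Integrable (fun x => l (ftrue x) (f x)) PX :=
    (MemLp.of_bound hmt.aestronglyMeasurable 1 (ae_of_all _ fun x => by
      rw [Real.norm_eq_abs, abs_of_nonneg (hl01 _ _).1]; exact (hl01 _ _).2) :
        MemLp _ 1 _).integrable le_rfl
  have hib : Integrable (fun x => p x * (l (yadv x) (f x) - l (ftrue x) (f x))) PX :=
    (MemLp.of_bound (by fun_prop) 1 (ae_of_all _ fun x => by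
      rw [Real.norm_eq_abs, abs_mul, abs_of_nonneg (hp01 x).1]
      refine mul_le_one₀ (hp01 x).2 (abs_nonneg _) (abs_le.2 ⟨?_, ?_⟩)
      · linarith [(hl01 (yadv x) (f x)).1, (hl01 (ftrue x) (f x)).2]
      · linarith [(hl01 (yadv x) (f x)).2, (hl01 (ftrue x) (f x)).1]) :
        MemLp (fun x => p x * (l (yadv x) (f x) - l (ftrue x) (f x))) 1 PX).integrable le_rfl
  rw [risk, bias, integral_congr_ae hae, ← integral_add hit hib]
  refine integral_congr_ae (ae_of_all _ fun x => ?_)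
  simp only [lossFun]
  ring

theorem integral_weightedLossFun_noisyDist (hft : Measurable ftrue) (hya : Measurable yadv)
    (hp : Measurable p) (hp01 : ∀ x, p x ∈ Set.Icc (0 : ℝ) 1)
    (hl : Measurable (Function.uncurry l)) (hf : Measurable f)
    (hpos : ∀ᵐ x ∂PX, 0 < p x → 0 < l (ftrue x) (f x) ∧
      1 + p x * (distortion l ftrue yadv f x - 1) ≠ 0)
    (hw01 : ∀ z, weightedLossFun l ftrue yadv p f z ∈ Set.Icc (0 : ℝ) 1) :
    ∫ z, weightedLossFun l ftrue yadv p f z ∂(noisyDist PX ftrue yadv p) =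
      risk PX l ftrue f := by
  rw [integral_noisyDist PX hft hya hp hp01
    (measurable_weightedLossFun hft hya hp hl hf) hw01, risk]
  refine integral_congr_ae ?_
  filter_upwards [hpos] with x hx
  simp only [weightedLossFun, weight]
  rcases (hp01 x).1.eq_or_lt with h0 | h0
  -- At `p x = 0` the weight is 1 whatever value the distortion takes, so only the clean label
  -- contributes.
  · simp [← h0]
  · obtain ⟨h1, h2⟩ := hx h0
    have h3 : p x * l (yadv x) (f x) + (1 - p x) * l (ftrue x) (f x) =
        (1 + p x * (distortion l ftrue yadv f x - 1)) * l (ftrue x) (f x) := by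
      have := h1.ne'
      rw [distortion]
      field_simp
      ring
    calc _ = 1 / (1 + p x * (distortion l ftrue yadv f x - 1)) *
          (p x * l (yadv x) (f x) + (1 - p x) * l (ftrue x) (f x)) := by ring
      _ = l (ftrue x) (f x) := by
        rw [h3, ← mul_assoc, one_div, inv_mul_cancel₀ h2, one_mul]

end NoisyDist

end Distillation

/-! ### Assembly for the two induced classes. -/

theorem mainTheorem3 :
    ∃ C : ℝ, 0 < C ∧
      ∀ (X : Type*) [MeasurableSpace X] (PX : Measure X) [IsProbabilityMeasure PX]
        (L : ℕ) (ftrue yadv : X → (Fin L → ℝ)) (p : X → ℝ)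
        (l : (Fin L → ℝ) → (Fin L → ℝ) → ℝ) (F : Set (X → (Fin L → ℝ))) (n : ℕ) (δ : ℝ),
        Measurable ftrue → Measurable yadv → Measurable p → (∀ x, p x ∈ Set.Icc (0 : ℝ) 1) →
        Measurable (Function.uncurry l) → (∀ y v, l y v ∈ Set.Icc (0 : ℝ) 1) →
        (∀ f ∈ F, Measurable f) →
        -- the distortion and the weight are well defined wherever the label can be corrupted
        (∀ f ∈ F, ∀ᵐ x ∂PX, 0 < p x →
          0 < l (ftrue x) (f x) ∧
            1 + p x * (Distillation.distortion l ftrue yadv f x - 1) ≠ 0) →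
        -- the weighted induced class also consists of `[0,1]`-valued functions
        (∀ f ∈ F, ∀ z,
          Distillation.weightedLossFun l ftrue yadv p f z ∈ Set.Icc (0 : ℝ) 1) →
        Distillation.MeasurableProjection (Distillation.lossFun l '' F)
          (Distillation.noisyDist PX ftrue yadv p) (2 * n) →
        Distillation.MeasurableProjection (Distillation.weightedLossFun l ftrue yadv p '' F)
          (Distillation.noisyDist PX ftrue yadv p) (2 * n) →
        0 < δ → 16 ≤ n →
        ∃ E : Set (Fin n → X × (Fin L → ℝ)), MeasurableSet E ∧
          ENNReal.ofReal (1 - δ) ≤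
            (Measure.pi fun _ : Fin n => Distillation.noisyDist PX ftrue yadv p) E ∧
          ∀ S ∈ E, ∀ f ∈ F,
            |Distillation.risk PX l ftrue f + Distillation.bias PX l ftrue yadv p f -
                Distillation.empRisk l S f| ≤
              C * Distillation.bernsteinRate
                (Distillation.sampleVariance fun i => Distillation.lossFun l f (S i))
                (Distillation.growthM (Distillation.lossFun l '' F) n) δ n ∧
            |Distillation.risk PX l ftrue f -
                Distillation.weightedEmpRisk l ftrue yadv p S f| ≤
              C * Distillation.bernsteinRate
                (Distillation.sampleVariance fun i =>
                  Distillation.weightedLossFun l ftrue yadv p f (S i))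
                (Distillation.growthM (Distillation.weightedLossFun l ftrue yadv p '' F) n)
                δ n := by
  refine ⟨100, by norm_num, ?_⟩
  intro X _ PX _ L ftrue yadv p l F n δ hft hya hp hp01 hl hl01 hF hwd hw01 hproj hprojw hδ hn
  -- For `δ ≥ 1` the required probability is nonpositive, so the empty event suffices.
  rcases le_or_gt 1 δ with h1δ | h1δ
  · exact ⟨∅, MeasurableSet.empty, by simp [ENNReal.ofReal_of_nonpos (sub_nonpos.2 h1δ)],
      fun S hS => hS.elim⟩
  have hD := Distillation.isProbabilityMeasure_noisyDist PX hft hya hp hp01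
  obtain ⟨B, hBm, hBμ, hB⟩ := Distillation.exists_measurableSet_forall_abs_le_bernsteinRate
    (Distillation.noisyDist PX ftrue yadv p) (H := Distillation.lossFun l '' F)
    (by rintro _ ⟨f, hf, rfl⟩; exact Distillation.measurable_lossFun hl (hF f hf))
    (by rintro _ ⟨f, hf, rfl⟩ z; exact hl01 _ _) hn hproj hδ h1δ
  obtain ⟨B', hBm', hBμ', hB'⟩ := Distillation.exists_measurableSet_forall_abs_le_bernsteinRate
    (Distillation.noisyDist PX ftrue yadv p)
    (H := Distillation.weightedLossFun l ftrue yadv p '' F)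
    (by
      rintro _ ⟨f, hf, rfl⟩
      exact Distillation.measurable_weightedLossFun hft hya hp hl (hF f hf))
    (by rintro _ ⟨f, hf, rfl⟩ z; exact hw01 f hf z) hn hprojw hδ h1δ
  have hunion := (measure_union_le B B').trans (add_le_add hBμ hBμ')
  rw [← ENNReal.ofReal_add (by linarith) (by linarith), add_halves] at hunion
  refine ⟨(B ∪ B')ᶜ, (hBm.union hBm').compl, ?_, fun S hS f hf => ?_⟩
  · rw [prob_compl_eq_one_sub (hBm.union hBm'), ENNReal.ofReal_sub _ hδ.le, ENNReal.ofReal_one]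
    exact tsub_le_tsub_left hunion 1
  · rw [Set.mem_compl_iff, Set.mem_union, not_or] at hS
    have hpos : ∀ᵐ x ∂PX, 0 < p x → 0 < l (ftrue x) (f x) :=
      (hwd f hf).mono fun x hx h0 => (hx h0).1
    constructor
    · rw [← Distillation.integral_lossFun_noisyDist PX hft hya hp hp01 hl hl01 (hF f hf) hpos]
      exact hB S hS.1 _ ⟨f, hf, rfl⟩
    · rw [← Distillation.integral_weightedLossFun_noisyDist PX hft hya hp hp01 hl (hF f hf)
        (hwd f hf) (hw01 f hf)]
      exact hB' S hS.2 _ ⟨f, hf, rfl⟩
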